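/- Let $G$ be an infinite finitely generated group, let $Q$ be a finite set with at least two elements, and let $\{X_n\}_{n\in\mathbb{N}}$ be an exhaustive sequence for $G$, i.e. a sequence of finite subsets with $X_n\subseteq X_{n+1}$ for all $n$ and $\bigcup_n X_n=G$. Suppose that $\{X_n\}$ contains an amenable (Følner) subsequence: there are $n_0<n_1<\cdots$ such that $\lim_{j\to\infty}|\partial_E X_{n_j}|/|X_{n_j}|=0$ for every finite nonempty $E\subseteq G$, where $\partial_E X=\{g\in G: gE\cap X\neq\emptyset\}\setminus X$. Let $\mathcal{A}=\langle Q,\mathcal{N},f\rangle$ be a cellular automaton over $G$, with finite nonempty $\mathcal{N}\subseteq G$ and $f:Q^{\mathcal{N}}\to Q$, and let $F_{\mathcal{A}}:Q^G\to Q^G$, $(F_{\mathcal{A}}(c))(g)=f\big((c^g)|_{\mathcal{N}}\big)$ with $c^g(h)=c(gh)$, be its global evolution function. For $c_1,c_2\in Q^G$ put $$d_B(c_1,c_2)=\limsup_{n\to\infty}\frac{|\{x\in X_n: c_1(x)\neq c_2(x)\}|}{|X_n|}.$$ Call $\mathcal{A}$ - *surjective* if $F_{\mathcal{A}}$ is surjective;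 - *$(B,\{X_n\})$-surjective* if for every $c\in Q^G$ there is $c'\in Q^G$ with $d_B(c,F_{\mathcal{A}}(c'))=0$; - *$(B,\{X_n\})$-injective* if $d_B(c_1,c_2)>0$ implies $d_B(F_{\mathcal{A}}(c_1),F_{\mathcal{A}}(c_2))>0$ for all $c_1,c_2\in Q^G$; - *preinjective* if there are no finite $E\subseteq G$ and distinct $p_1,p_2\in Q^E$ that are mutually erasable, i.e. such that $F_{\mathcal{A}}(c_1)=F_{\mathcal{A}}(c_2)$ for all $c_1,c_2\in Q^G$ with $c_1|_E=p_1$, $c_2|_E=p_2$ and $c_1|_{G\setminus E}=c_2|_{G\setminus E}$. Then: 1. If $\mathcal{A}$ is $(B,\{X_n\})$-surjective, then it is surjective. 2. If $\mathcal{A}$ is $(B,\{X_n\})$-injective, then it is preinjective. 3. If $\mathcal{A}$ is $(B,\{X_n\})$-injective, then it is $(B,\{X_n\})$-surjective. -/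

import Mathlib

open Filter Topology

namespace Besicovitch

/-- The closure `X^{+E} = {g : gE ∩ X ≠ ∅} = X E⁻¹` of a finite set `X` with respect to `E`. -/
def closureWrt {G : Type*} [Group G] (E X : Finset G) : Set G :=
  {g : G | ∃ e ∈ E, g * e ∈ X}

/-- The boundary `∂_E X = X^{+E} \ X`. -/
def boundaryWrt {G : Type*} [Group G] (E X : Finset G) : Set G :=
  closureWrt E X \ (X : Set G)

/-- The boundary is a finite set, so that its `Set.ncard` below is its true cardinality. -/
theorem boundaryWrt_finite {G : Type*} [Group G] (E X : Finset G) :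
    (boundaryWrt E X).Finite := by
  refine Set.Finite.subset ((E ×ˢ X).finite_toSet.image fun p => p.2 * p.1⁻¹) ?_
  rintro g ⟨⟨e, he, hx⟩, -⟩
  exact ⟨(e, g * e), by simp [he, hx], by simp⟩

/-- A sequence of finite subsets is exhaustive if it is increasing with union `G`. -/
def IsExhaustive {G : Type*} (X : ℕ → Finset G) : Prop :=
  (∀ n, X n ⊆ X (n + 1)) ∧ (⋃ n, (X n : Set G)) = Set.univ

/-- An amenable (Følner) sequence: exhaustive, with `|∂_E X_n| / |X_n| → 0` for every finite
nonempty `E`. -/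
def IsAmenableSeq {G : Type*} [Group G] (X : ℕ → Finset G) : Prop :=
  IsExhaustive X ∧
    ∀ E : Finset G, E.Nonempty →
      Tendsto (fun n => ((boundaryWrt E (X n)).ncard : ℝ) / ((X n).card : ℝ)) atTop (𝓝 0)

/-- `X` has an amenable subsequence. -/
def HasAmenableSubseq {G : Type*} [Group G] (X : ℕ → Finset G) : Prop :=
  ∃ φ : ℕ → ℕ, StrictMono φ ∧ IsAmenableSeq (X ∘ φ)

/-- The translateConfig `c^g` of a configuration: `c^g(h) = c(gh)`. -/
def translateConfig {G Q : Type*} [Group G] (c : G → Q) (g : G) : G → Q :=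
  fun h => c (g * h)

/-- A cellular automaton over `G` with set of states `Q`: a finite nonempty neighborhood index
and a local evolution function. (`Q` is required to be finite with at least two elements where
cellular automata are used.) -/
structure CellularAutomaton (G Q : Type*) where
  /-- The neighborhood index. -/
  nbhd : Finset G
  nbhd_nonempty : nbhd.Nonempty
  /-- The local evolution function. -/
  localMap : (nbhd → Q) → Q

/-- The global evolution function: `(F c)_g = f ((c^g)|_N)`. -/
def CellularAutomaton.globalMap {G Q : Type*} [Group G] (A : CellularAutomaton G Q) :
    (G → Q) → (G → Q) :=
  fun c g => A.localMap (fun x : A.nbhd => translateConfig c g (x : G))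

/-- Two patterns with common finite support `E` are mutually erasable for `A` if any two
configurations that extend them and agree off `E` have the same image. -/
def CellularAutomaton.MutuallyErasable {G Q : Type*} [Group G] (A : CellularAutomaton G Q)
    (E : Finset G) (p₁ p₂ : E → Q) : Prop :=
  ∀ c₁ c₂ : G → Q, (∀ x : E, c₁ x = p₁ x) → (∀ x : E, c₂ x = p₂ x) →
    (∀ g, g ∉ E → c₁ g = c₂ g) → A.globalMap c₁ = A.globalMap c₂

/-- `A` is preinjective if it has no two distinct mutually erasable patterns. -/
def CellularAutomaton.Preinjective {G Q : Type*} [Group G] (A : CellularAutomaton G Q) : Prop :=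
  ¬ ∃ (E : Finset G) (p₁ p₂ : E → Q), p₁ ≠ p₂ ∧ A.MutuallyErasable E p₁ p₂

/-- The Hamming pseudodistance `|{x ∈ U : c₁ x ≠ c₂ x}|`. -/
noncomputable def hamming {G Q : Type*} (U : Finset G) (c₁ c₂ : G → Q) : ℕ :=
  {x : G | x ∈ U ∧ c₁ x ≠ c₂ x}.ncard

/-- The Besicovitch pseudodistance with respect to `X`: the upper limit of
`H_{X_n}(c₁, c₂) / |X_n|`, a sequence with values in `[0, 1]`. -/
noncomputable def besicovitchDist {G Q : Type*} (X : ℕ → Finset G) (c₁ c₂ : G → Q) : ℝ :=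
  limsup (fun n => (hamming (X n) c₁ c₂ : ℝ) / ((X n).card : ℝ)) atTop

/-- `(B, X)`-surjectivity of a transformation of the configuration space. -/
def BSurjective {G Q : Type*} (X : ℕ → Finset G) (F : (G → Q) → (G → Q)) : Prop :=
  ∀ c : G → Q, ∃ c' : G → Q, besicovitchDist X c (F c') = 0

/-- `(B, X)`-injectivity of a transformation of the configuration space. -/
def BInjective {G Q : Type*} (X : ℕ → Finset G) (F : (G → Q) → (G → Q)) : Prop :=
  ∀ c₁ c₂ : G → Q, 0 < besicovitchDist X c₁ c₂ → 0 < besicovitchDist X (F c₁) (F c₂)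

end Besicovitch

/-!
Fix a finite nonempty `E ⊆ G` and choose, by Zorn's lemma, a maximal set `S ⊆ G` whose tiles
`s * E`, `s ∈ S`, are pairwise disjoint. By maximality every `g * E` meets one of the tiles, so a
finite set `U` contains at least a fixed proportion of `U.card` of them, up to an error
controlled by a boundary of `U`. Along a Følner subsequence the error is negligible, so two
configurations that differ somewhere on every tile are at positive Besicovitch distance
(`besicovitchDist_pos_of_isTileNet`).

* If the global map is not surjective, compactness of `G → Q` gives an orphan: a pattern on a
  finite `E` which no image exhibits. By translation invariance, a configuration with the orphan
  planted on all tiles differs on every tile from every image, so the map is not `B`-surjective.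
* If `p₁ ≠ p₂` are mutually erasable on `E`, planting `p₁`, respectively `p₂`, on all tiles gives
  configurations at positive distance. Their images are equal, since the image at one point sees
  only finitely many tiles, and these can be exchanged one at a time. So the map is not
  `B`-injective.
* `B`-injectivity implies `B`-surjectivity because preinjectivity implies surjectivity
  (`CellularAutomaton.Preinjective.surjective`, the theorem of Myhill for amenable groups).
  Write `q` for the number of states. If there is an orphan on `E` and `U` contains `t` disjoint
  tiles, then the images have at most `q ^ |V| * (1 - q ^ (-|E|)) ^ t` restrictions to
  `V = U ∪ ∂U`, each tile costing a factor `1 - q ^ (-|E|)` (`card_avoiding_le`). For `U` far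
  along the Følner sequence this is less than `q ^ |U|`, so two configurations that agree off `U`
  have equal images, and they yield mutually erasable patterns.
-/

namespace Besicovitch

/-! ### Packings by translates of a finite set -/

/-- The tiles `s * E`, `s ∈ S`, are pairwise disjoint. For empty `E` this says nothing. -/
def IsTilePacking {G : Type*} [Group G] (E : Finset G) (S : Set G) : Prop :=
  ∀ s ∈ S, ∀ t ∈ S, ∀ e ∈ E, ∀ f ∈ E, s * e = t * f → s = t

/-- A packing by tiles `s * E` such that every translate `g * E` meets one of the tiles. -/
def IsTileNet {G : Type*} [Group G] (E : Finset G) (S : Set G) : Prop :=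
  IsTilePacking E S ∧ ∀ g : G, ∃ s ∈ S, ∃ e ∈ E, ∃ f ∈ E, g * e = s * f

/-- The centres `s ∈ S` of the tiles `s * E` contained in `U`. -/
def tilesIn {G : Type*} [Group G] (E : Finset G) (S : Set G) (U : Finset G) : Set G :=
  {s ∈ S | ∀ e ∈ E, s * e ∈ U}

theorem exists_isTileNet {G : Type*} [Group G] {E : Finset G} (hE : E.Nonempty) :
    ∃ S : Set G, IsTileNet E S := by
  obtain ⟨S, hS⟩ := zorn_subset {S : Set G | IsTilePacking E S} (by
    intro C hC hchain
    refine ⟨⋃₀ C, ?_, fun s hs => Set.subset_sUnion_of_mem hs⟩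
    rintro s ⟨U, hU, hsU⟩ t ⟨V, hV, htV⟩
    rcases hchain.total hU hV with h | h
    · exact hC hV s (h hsU) t htV
    · exact hC hU s hsU t (h htV))
  refine ⟨S, hS.prop, fun g => ?_⟩
  by_contra! hg
  have hins : IsTilePacking E (insert g S) := by
    rintro s (rfl | hs) t (rfl | ht) e he f hf h
    · rfl
    · exact absurd h (hg t ht e he f hf)
    · exact absurd h.symm (hg s hs f hf e he)
    · exact hS.prop s hs t ht e he f hf h
  obtain ⟨e, he⟩ := hE
  exact hg g (hS.le_of_ge hins (Set.subset_insert g S) (Set.mem_insert g S)) e he e he rfl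

theorem tilesIn_finite {G : Type*} [Group G] {E : Finset G} (hE : E.Nonempty) (S : Set G)
    (U : Finset G) : (tilesIn E S U).Finite := by
  obtain ⟨e, he⟩ := hE
  exact Set.Finite.of_injOn (f := fun s => s * e) (t := (U : Set G))
    (fun s hs => hs.2 e he) (fun a _ b _ h => mul_right_cancel h) U.finite_toSet

/-- With `K = E⁻¹ * E * E⁻¹`, a point `g ∈ U` either satisfies `g * k⁻¹ ∉ U` for some `k ∈ K`,
in which case `g * k⁻¹` lies in `∂_K U`, or the tile met by `g * E` lies in `U`. A tile serves at
most `|E| ^ 2` points `g`, and a boundary point at most `|K|`. -/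
theorem card_le_tilesIn_add_boundaryWrt {G : Type*} [Group G] {E : Finset G} (hE : E.Nonempty)
    {S : Set G} (hS : IsTileNet E S) :
    ∃ K : Finset G, K.Nonempty ∧ ∀ U : Finset G,
      U.card ≤ E.card * E.card * (tilesIn E S U).ncard + K.card * (boundaryWrt K U).ncard := by
  classical
  let K : Finset G := (E ×ˢ E ×ˢ E).image fun p => p.1⁻¹ * p.2.1 * p.2.2⁻¹
  have hK : ∀ e ∈ E, ∀ f ∈ E, ∀ h ∈ E, e⁻¹ * f * h⁻¹ ∈ K := fun e he f hf h hh =>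
    Finset.mem_image.2 ⟨(e, f, h), by simp [he, hf, hh], rfl⟩
  refine ⟨K, ?_, fun U => ?_⟩
  · obtain ⟨e, he⟩ := hE
    exact ⟨_, hK e he e he e he⟩
  · have hT := tilesIn_finite hE S U
    have hB := boundaryWrt_finite K U
    have hsub : U ⊆ ((E ×ˢ E) ×ˢ hT.toFinset).image (fun p => p.2 * p.1.1 * p.1.2⁻¹) ∪
        (K ×ˢ hB.toFinset).image (fun p => p.2 * p.1) := by
      intro g hg
      rw [Finset.mem_union]
      by_cases hk : ∃ k ∈ K, g * k⁻¹ ∉ U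
      · obtain ⟨k, hkK, hk⟩ := hk
        refine Or.inr (Finset.mem_image.2 ⟨(k, g * k⁻¹), ?_, by simp⟩)
        simp only [Finset.mem_product, Set.Finite.mem_toFinset]
        exact ⟨hkK, ⟨k, hkK, by simpa using hg⟩, by simpa using hk⟩
      · push Not at hk
        obtain ⟨s, hs, e, he, f, hf, h⟩ := hS.2 g
        refine Or.inl (Finset.mem_image.2 ⟨((f, e), s), ?_, by simp [← h]⟩)
        simp only [Finset.mem_product, Set.Finite.mem_toFinset]
        refine ⟨⟨hf, he⟩, hs, fun d hd => ?_⟩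
        have := hk _ (hK d hd f hf e he)
        have hs' : s = g * e * f⁻¹ := by simp [h]
        rw [hs']
        simpa [mul_assoc] using this
    calc U.card ≤ _ := Finset.card_le_card hsub
      _ ≤ _ := Finset.card_union_le _ _
      _ ≤ _ := by
        gcongr
        · refine Finset.card_image_le.trans ?_
          rw [Finset.card_product, Finset.card_product, Set.ncard_eq_toFinset_card _ hT]
        · refine Finset.card_image_le.trans ?_
          rw [Finset.card_product, Set.ncard_eq_toFinset_card _ hB]

/-! ### Density of the tiles along a Følner sequence -/

theorem IsAmenableSeq.eventually_card_pos {G : Type*} [Group G] {Y : ℕ → Finset G}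
    (hY : IsAmenableSeq Y) : ∀ᶠ n in atTop, 0 < (Y n).card := by
  have h1 : (1 : G) ∈ ⋃ n, (Y n : Set G) := by rw [hY.1.2]; trivial
  obtain ⟨n, hn⟩ := Set.mem_iUnion.1 h1
  filter_upwards [eventually_ge_atTop n] with m hm
  exact Finset.card_pos.2 ⟨1, monotone_nat_of_le_succ hY.1.1 hm hn⟩

theorem IsAmenableSeq.eventually_boundary_le {G : Type*} [Group G] {Y : ℕ → Finset G}
    (hY : IsAmenableSeq Y) {K : Finset G} (hK : K.Nonempty) {ε : ℝ} (hε : 0 < ε) :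
    ∀ᶠ n in atTop, ((boundaryWrt K (Y n)).ncard : ℝ) ≤ ε * (Y n).card := by
  filter_upwards [(hY.2 K hK).eventually_le_const hε, hY.eventually_card_pos] with n hn hpos
  rwa [div_le_iff₀ (by exact_mod_cast hpos)] at hn

/-- The tiles of a net contained in the sets of a Følner sequence have positive lower density. -/
theorem IsTileNet.eventually_density_le {G : Type*} [Group G] {E : Finset G} (hE : E.Nonempty)
    {S : Set G} (hS : IsTileNet E S) {Y : ℕ → Finset G} (hY : IsAmenableSeq Y) :
    ∃ δ : ℝ, 0 < δ ∧
      ∀ᶠ n in atTop, δ * (Y n).card ≤ ((tilesIn E S (Y n)).ncard : ℝ) := by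
  obtain ⟨K, hK, hcard⟩ := card_le_tilesIn_add_boundaryWrt hE hS
  have hE0 : (0 : ℝ) < E.card := by exact_mod_cast hE.card_pos
  have hK0 : (0 : ℝ) < K.card := by exact_mod_cast hK.card_pos
  -- The boundary term of `hcard` is eventually at most half of `(Y n).card`; the tiles account
  -- for the other half.
  refine ⟨1 / (2 * (E.card * E.card)), by positivity, ?_⟩
  filter_upwards [hY.eventually_boundary_le hK (ε := 1 / (2 * K.card)) (by positivity)] with n hn
  have h : ((Y n).card : ℝ) ≤ E.card * E.card * (tilesIn E S (Y n)).ncard +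
      K.card * (boundaryWrt K (Y n)).ncard := by exact_mod_cast hcard (Y n)
  have h2 : (K.card : ℝ) * (boundaryWrt K (Y n)).ncard ≤ (Y n).card / 2 := by
    calc _ ≤ (K.card : ℝ) * (1 / (2 * K.card) * (Y n).card) := by gcongr
      _ = _ := by field_simp
  rw [div_mul_eq_mul_div, div_le_iff₀ (by positivity)]
  linarith

/-! ### Besicovitch distance -/

theorem besicovitchDist_self {G Q : Type*} (X : ℕ → Finset G) (c : G → Q) :
    besicovitchDist X c c = 0 := by
  simp [besicovitchDist, hamming]

theorem hamming_le_card {G Q : Type*} (U : Finset G) (c₁ c₂ : G → Q) :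
    hamming U c₁ c₂ ≤ U.card := by
  rw [← Set.ncard_coe_finset U]
  exact Set.ncard_le_ncard (fun x hx => hx.1) U.finite_toSet

theorem tilesIn_ncard_le_hamming {G Q : Type*} [Group G] {E : Finset G} {S : Set G}
    (hS : IsTilePacking E S) {c₁ c₂ : G → Q}
    (hc : ∀ s ∈ S, ∃ e ∈ E, c₁ (s * e) ≠ c₂ (s * e)) (U : Finset G) :
    (tilesIn E S U).ncard ≤ hamming U c₁ c₂ := by
  choose! e he hne using hc
  exact Set.ncard_le_ncard_of_injOn (fun s => s * e s)
    (fun s hs => ⟨hs.2 _ (he s hs.1), hne s hs.1⟩)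
    (fun s hs t ht h => hS s hs.1 t ht.1 _ (he s hs.1) _ (he t ht.1) h)
    (U.finite_toSet.subset fun x hx => hx.1)

/-- Configurations that differ somewhere on every tile of a net are at positive distance. Only a
subsequence need be Følner, as the distance is an upper limit. -/
theorem besicovitchDist_pos_of_isTileNet {G Q : Type*} [Group G] {X : ℕ → Finset G}
    (hX : HasAmenableSubseq X) {E : Finset G} (hE : E.Nonempty) {S : Set G}
    (hS : IsTileNet E S) {c₁ c₂ : G → Q}
    (hc : ∀ s ∈ S, ∃ e ∈ E, c₁ (s * e) ≠ c₂ (s * e)) :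
    0 < besicovitchDist X c₁ c₂ := by
  obtain ⟨φ, hφ, hY⟩ := hX
  obtain ⟨δ, hδ, hden⟩ := hS.eventually_density_le hE hY
  refine hδ.trans_le (le_limsup_of_frequently_le ?_ ?_)
  · refine hφ.tendsto_atTop.frequently (Eventually.frequently ?_)
    filter_upwards [hden, hY.eventually_card_pos] with n hn hpos
    rw [le_div_iff₀ (by exact_mod_cast hpos)]
    exact hn.trans (by exact_mod_cast tilesIn_ncard_le_hamming hS.1 hc _)
  · refine isBoundedUnder_of ⟨1, fun n => div_le_one_of_le₀ ?_ (by positivity)⟩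
    exact_mod_cast hamming_le_card _ _ _

/-! ### Planting a pattern on a packing -/

open scoped Classical in
/-- The configuration that carries a copy of `p|_E` on each tile `s * E`, `s ∈ S`, and equals `b`
off the tiles. Only the values of `p` on `E` matter. If the tiles overlap, the copy used at an
overlap is an arbitrary one. -/
noncomputable def plant {G Q : Type*} [Group G] (E : Finset G) (S : Set G) (p b : G → Q) :
    G → Q :=
  fun x => if h : ∃ s ∈ S, s⁻¹ * x ∈ E then p (h.choose⁻¹ * x) else b x

theorem plant_apply {G Q : Type*} [Group G] {E : Finset G} {S : Set G}
    (hS : IsTilePacking E S) (p b : G → Q) {s e : G} (hs : s ∈ S) (he : e ∈ E) :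
    plant E S p b (s * e) = p e := by
  have h : ∃ t ∈ S, t⁻¹ * (s * e) ∈ E := ⟨s, hs, by simpa using he⟩
  have hst : h.choose = s :=
    hS _ h.choose_spec.1 s hs _ h.choose_spec.2 e he (by simp)
  rw [plant, dif_pos h, hst, inv_mul_cancel_left]

theorem plant_of_notMem {G Q : Type*} [Group G] {E : Finset G} {S : Set G} (p b : G → Q) {x : G}
    (hx : ∀ s ∈ S, s⁻¹ * x ∉ E) : plant E S p b x = b x :=
  dif_neg (by push Not; exact hx)

/-! ### Orphans and `B`-surjectivity -/

namespace CellularAutomaton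

variable {G Q : Type*} [Group G] (A : CellularAutomaton G Q)

theorem globalMap_congr {c c' : G → Q} {g : G}
    (h : ∀ x ∈ A.nbhd, c (g * x) = c' (g * x)) : A.globalMap c g = A.globalMap c' g :=
  congrArg A.localMap (funext fun x => h x x.2)

theorem globalMap_translateConfig (c : G → Q) (s : G) :
    A.globalMap (translateConfig c s) = translateConfig (A.globalMap c) s := by
  funext g
  simp only [globalMap, translateConfig, mul_assoc]

/-- The image of the global map is closed in the product topology, so a configuration outside it
is already excluded by its restriction to some finite set. -/
theorem exists_orphan [Finite Q] (h : ¬ Function.Surjective A.globalMap) :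
    ∃ (E : Finset G) (p : G → Q), ∀ c : G → Q, ∃ e ∈ E, A.globalMap c e ≠ p e := by
  let _ : TopologicalSpace Q := ⊥
  have : DiscreteTopology Q := ⟨rfl⟩
  have hcont : Continuous A.globalMap := continuous_pi fun g =>
    (continuous_of_discreteTopology (f := A.localMap)).comp
      (continuous_pi fun x => continuous_apply (g * (x : G)))
  have hclosed : IsClosed (Set.range A.globalMap) := (isCompact_range hcont).isClosed
  simp only [Function.Surjective, not_forall] at h
  obtain ⟨p, hp⟩ := h
  obtain ⟨E, u, hu, hsub⟩ := isOpen_pi_iff.1 hclosed.isOpen_compl p hp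
  refine ⟨E, p, fun c => ?_⟩
  by_contra! hc
  exact hsub (fun e he => by rw [hc e he]; exact (hu e he).2) ⟨c, rfl⟩

variable {A}

theorem orphan_translate {E : Finset G} {p : G → Q}
    (hp : ∀ c : G → Q, ∃ e ∈ E, A.globalMap c e ≠ p e) (c : G → Q) (s : G) :
    ∃ e ∈ E, A.globalMap c (s * e) ≠ p e := by
  have h := hp (translateConfig c s)
  rwa [globalMap_translateConfig] at h

theorem surjective_of_bSurjective [Finite Q] [Nonempty Q] {X : ℕ → Finset G}
    (hX : HasAmenableSubseq X) (h : BSurjective X A.globalMap) :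
    Function.Surjective A.globalMap := by
  by_contra hns
  obtain ⟨E, p, hp⟩ := A.exists_orphan hns
  have hE : E.Nonempty := (hp p).imp fun _ h => h.1
  obtain ⟨S, hS⟩ := exists_isTileNet hE
  obtain ⟨c', hc'⟩ := h (plant E S p p)
  refine hc'.not_gt (besicovitchDist_pos_of_isTileNet hX hE hS fun s hs => ?_)
  obtain ⟨e, he, hne⟩ := orphan_translate hp c' s
  exact ⟨e, he, by rw [plant_apply hS.1 _ _ hs he]; exact hne.symm⟩

/-! ### Erasable patterns and `B`-injectivity -/

theorem MutuallyErasable.globalMap_eq_of_tile {E : Finset G} {p₁ p₂ : E → Q}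
    (h : A.MutuallyErasable E p₁ p₂) {s : G} {c₁ c₂ : G → Q} (h₁ : ∀ x : E, c₁ (s * x) = p₁ x)
    (h₂ : ∀ x : E, c₂ (s * x) = p₂ x) (hoff : ∀ g, s⁻¹ * g ∉ E → c₁ g = c₂ g) :
    A.globalMap c₁ = A.globalMap c₂ := by
  have := h (translateConfig c₁ s) (translateConfig c₂ s) h₁ h₂
    fun g hg => hoff _ (by simpa using hg)
  rw [globalMap_translateConfig, globalMap_translateConfig] at this
  funext g
  simpa [translateConfig] using congrFun this (s⁻¹ * g)

theorem MutuallyErasable.globalMap_eq_of_finset {E : Finset G} {p₁ p₂ : E → Q}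
    (h : A.MutuallyErasable E p₁ p₂) (D : Finset G) (hD : IsTilePacking E (D : Set G))
    {c₁ c₂ : G → Q} (h₁ : ∀ s ∈ D, ∀ x : E, c₁ (s * x) = p₁ x)
    (h₂ : ∀ s ∈ D, ∀ x : E, c₂ (s * x) = p₂ x)
    (hoff : ∀ g, (∀ s ∈ D, s⁻¹ * g ∉ E) → c₁ g = c₂ g) :
    A.globalMap c₁ = A.globalMap c₂ := by
  classical
  induction D using Finset.induction_on generalizing c₁ with
  | empty => exact congrArg _ (funext fun g => hoff g (by simp))
  | insert s D hs ih =>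
    have hsD : s ∈ insert s D := Finset.mem_insert_self s D
    have hDs : ∀ t ∈ D, t ∈ insert s D := fun t => Finset.mem_insert_of_mem
    -- `c` exchanges `p₁` for `p₂` on the tile of `s` only.
    let c : G → Q := fun g => if s⁻¹ * g ∈ E then c₂ g else c₁ g
    have h1 : A.globalMap c₁ = A.globalMap c := by
      refine h.globalMap_eq_of_tile (h₁ s hsD) (fun x => ?_) fun g hg => (if_neg hg).symm
      simp only [c, inv_mul_cancel_left, x.2, if_true, h₂ s hsD x]
    rw [h1]
    refine ih (fun a ha b hb => hD a (hDs a ha) b (hDs b hb)) (fun t ht x => ?_)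
      (fun t ht => h₂ t (hDs t ht)) fun g hg => ?_
    · have hx : s⁻¹ * (t * x) ∉ E := fun hmem => hs <| by
        rwa [hD s hsD t (hDs t ht) _ hmem x x.2 (by simp)]
      simp only [c, if_neg hx, h₁ t (hDs t ht) x]
    · by_cases hsg : s⁻¹ * g ∈ E
      · simp only [c, if_pos hsg]
      · simp only [c, if_neg hsg]
        refine hoff g fun t ht => ?_
        rcases Finset.mem_insert.1 ht with rfl | ht
        · exact hsg
        · exact hg t ht

/-- Mutually erasable patterns can be exchanged on infinitely many tiles at once, since the image
at a given point depends on finitely many of them. -/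
theorem MutuallyErasable.globalMap_eq {E : Finset G} {p₁ p₂ : E → Q}
    (h : A.MutuallyErasable E p₁ p₂) {S : Set G} (hS : IsTilePacking E S) {c₁ c₂ : G → Q}
    (h₁ : ∀ s ∈ S, ∀ x : E, c₁ (s * x) = p₁ x) (h₂ : ∀ s ∈ S, ∀ x : E, c₂ (s * x) = p₂ x)
    (hoff : ∀ g, (∀ s ∈ S, s⁻¹ * g ∉ E) → c₁ g = c₂ g) :
    A.globalMap c₁ = A.globalMap c₂ := by
  classical
  funext g
  -- `D` consists of the centres of the tiles that meet the neighbourhood of `g`.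
  let D : Finset G := {s ∈ (A.nbhd ×ˢ E).image (fun p => g * p.1 * p.2⁻¹) | s ∈ S}
  have hDS : ∀ s ∈ D, s ∈ S := fun s hs => (Finset.mem_filter.1 hs).2
  let c : G → Q := fun x => if ∃ s ∈ D, s⁻¹ * x ∈ E then c₂ x else c₁ x
  have h1 : A.globalMap c₁ = A.globalMap c := by
    refine h.globalMap_eq_of_finset D (fun a ha b hb => hS a (hDS a ha) b (hDS b hb))
      (fun s hs => h₁ s (hDS s hs)) (fun s hs x => ?_) fun x hx => ?_
    · have : ∃ t ∈ D, t⁻¹ * (s * x) ∈ E := ⟨s, hs, by simp⟩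
      simp only [c, if_pos this, h₂ s (hDS s hs) x]
    · have : ¬ ∃ t ∈ D, t⁻¹ * x ∈ E := by push Not; exact hx
      simp only [c, if_neg this]
  rw [h1]
  refine A.globalMap_congr fun n hn => ?_
  by_cases hD : ∃ t ∈ D, t⁻¹ * (g * n) ∈ E
  · simp only [c, if_pos hD]
  · simp only [c, if_neg hD]
    refine hoff _ fun s hs hmem => hD ⟨s, Finset.mem_filter.2 ⟨?_, hs⟩, hmem⟩
    exact Finset.mem_image.2 ⟨(n, s⁻¹ * (g * n)), Finset.mem_product.2 ⟨hn, hmem⟩,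
      by simp [mul_assoc]⟩

theorem preinjective_of_bInjective [Nonempty Q] {X : ℕ → Finset G}
    (hX : HasAmenableSubseq X) (h : BInjective X A.globalMap) : A.Preinjective := by
  classical
  rintro ⟨E, p₁, p₂, hne, her⟩
  obtain ⟨⟨e, he⟩, hee⟩ := Function.ne_iff.1 hne
  have hE : E.Nonempty := ⟨e, he⟩
  obtain ⟨S, hS⟩ := exists_isTileNet hE
  let b : G → Q := fun _ => Classical.arbitrary Q
  let c : (E → Q) → G → Q := fun p =>
    plant E S (fun g => if hg : g ∈ E then p ⟨g, hg⟩ else Classical.arbitrary Q) b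
  have hc : ∀ p, ∀ s ∈ S, ∀ x : E, c p (s * x) = p x := fun p s hs x => by
    simp only [c, plant_apply hS.1 _ _ hs x.2, x.2, dif_pos]
  have heq : A.globalMap (c p₁) = A.globalMap (c p₂) :=
    her.globalMap_eq hS.1 (hc p₁) (hc p₂) fun g hg => by
      simp only [c, plant_of_notMem _ _ hg]
  have hpos : 0 < besicovitchDist X (c p₁) (c p₂) :=
    besicovitchDist_pos_of_isTileNet hX hE hS fun s hs =>
      ⟨e, he, by rw [hc p₁ s hs ⟨e, he⟩, hc p₂ s hs ⟨e, he⟩]; exact hee⟩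
  have := h _ _ hpos
  rw [heq, besicovitchDist_self] at this
  exact lt_irrefl _ this

end CellularAutomaton

/-! ### Counting patterns that avoid an orphan -/

/-- Among the `α`-patterns, those that avoid `p` on each of the disjoint tiles `τ i`, `i ∈ T`, form
a proportion of at most `(1 - q ^ (-m)) ^ |T|`, where `q = |Q|` and `m` is the size of a tile. -/
theorem card_avoiding_le {α ι ε Q : Type*} [Fintype α] [Fintype ε] [Fintype Q]
    [Nonempty Q] (τ : ι → ε → α) (hτ : ∀ i j e f, τ i e = τ j f → i = j ∧ e = f)
    (p : ε → Q) (T : Finset ι) :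
    ({y : α → Q | ∀ i ∈ T, ∃ e, y (τ i e) ≠ p e}.ncard : ℝ) ≤
      (Fintype.card Q : ℝ) ^ Fintype.card α *
        (1 - ((Fintype.card Q : ℝ) ^ Fintype.card ε)⁻¹) ^ T.card := by
  classical
  have hfin : ∀ T : Finset ι, {y : α → Q | ∀ i ∈ T, ∃ e, y (τ i e) ≠ p e}.ncard =
      ({y : α → Q | ∀ i ∈ T, ∃ e, y (τ i e) ≠ p e} : Finset (α → Q)).card := fun T => by
    rw [← Set.ncard_coe_finset, Finset.coe_filter_univ]
  rw [hfin]
  set q : ℝ := (Fintype.card Q : ℝ) with hqdef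
  have hq : 1 ≤ q := Nat.one_le_cast.2 Fintype.card_pos
  have hqm : 1 ≤ q ^ Fintype.card ε := one_le_pow₀ hq
  induction T using Finset.induction_on with
  | empty => simp [q]
  | insert i T hi ih =>
    set B : Finset (α → Q) := {y : α → Q | ∀ i ∈ T, ∃ e, y (τ i e) ≠ p e} with hB
    set B' : Finset (α → Q) := {y : α → Q | ∀ j ∈ insert i T, ∃ e, y (τ j e) ≠ p e} with hB'
    have hsub : B' ⊆ B := fun y hy => by
      simp only [hB, hB', Finset.mem_filter, Finset.mem_univ, true_and] at hy ⊢
      exact fun j hj => hy j (Finset.mem_insert_of_mem hj)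
    -- `r` overwrites the tile `i` by `p`. It maps `B` to `B \ B'`, and each fibre has at most
    -- `q ^ m` elements, so that `|B| ≤ q ^ m * (|B| - |B'|)`.
    let r : (α → Q) → α → Q := fun y a => if h : ∃ e, τ i e = a then p h.choose else y a
    have hri : ∀ y e, r y (τ i e) = p e := fun y e => by
      have h : ∃ f, τ i f = τ i e := ⟨e, rfl⟩
      simp only [r, dif_pos h, (hτ _ _ _ _ h.choose_spec).2]
    have hrn : ∀ y a, (∀ e, τ i e ≠ a) → r y a = y a := fun y a h =>
      dif_neg (by push Not; exact h)
    have hmaps : ∀ y ∈ B, r y ∈ B \ B' := fun y hy => by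
      simp only [hB, hB', Finset.mem_sdiff, Finset.mem_filter, Finset.mem_univ, true_and] at hy ⊢
      refine ⟨fun j hj => ?_, fun h => ?_⟩
      · obtain ⟨e, he⟩ := hy j hj
        refine ⟨e, ?_⟩
        rwa [hrn _ _ fun f hf => hi ((hτ _ _ _ _ hf).1 ▸ hj)]
      · obtain ⟨e, he⟩ := h i (Finset.mem_insert_self i T)
        exact he (hri y e)
    have hfib : ∀ z ∈ B \ B', (B.filter fun y => r y = z).card ≤
        Fintype.card Q ^ Fintype.card ε := fun z _ => by
      rw [← Fintype.card_fun, ← Finset.card_univ]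
      refine Finset.card_le_card_of_injOn (fun y e => y (τ i e))
        (fun _ _ => Finset.mem_coe.2 (Finset.mem_univ _)) ?_
      intro y hy w hw hyw
      simp only [Finset.mem_coe, Finset.mem_filter] at hy hw
      funext a
      by_cases ha : ∃ e, τ i e = a
      · obtain ⟨e, rfl⟩ := ha
        exact congrFun hyw e
      · push Not at ha
        rw [← hrn y a ha, ← hrn w a ha, hy.2, hw.2]
    have hcard := Finset.card_le_mul_card_image_of_maps_to hmaps _ hfib
    rw [Finset.card_sdiff_of_subset hsub] at hcard
    have hcard' : (B.card : ℝ) ≤ q ^ Fintype.card ε * (B.card - B'.card) := by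
      rw [← Nat.cast_sub (Finset.card_le_card hsub), hqdef]
      exact_mod_cast hcard
    have hstep : (B'.card : ℝ) ≤ B.card * (1 - (q ^ Fintype.card ε)⁻¹) := by
      have : (B.card : ℝ) * (q ^ Fintype.card ε)⁻¹ ≤ B.card - B'.card := by
        rw [← div_eq_mul_inv, div_le_iff₀ (by positivity)]
        linarith
      linarith
    rw [Finset.card_insert_of_notMem hi, pow_succ, ← mul_assoc]
    refine hstep.trans ?_
    gcongr
    exact sub_nonneg.2 (inv_le_one_of_one_le₀ hqm)

/-! ### Preinjective automata over amenable groups are surjective -/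

namespace CellularAutomaton

variable {G Q : Type*} [Group G] {A : CellularAutomaton G Q}

/-- If `c₁` and `c₂` differ only inside `U` and have the same image, their restrictions to
`E = U * N⁻¹ * N` are mutually erasable, where `N` is the neighborhood: whether `g * N` meets `U`,
so that `g * N ⊆ E`, or not, the image at `g` does not distinguish the two patterns. -/
theorem not_preinjective_of_globalMap_eq {U : Finset G} {c₁ c₂ : G → Q} (hne : c₁ ≠ c₂)
    (hoff : ∀ g, g ∉ U → c₁ g = c₂ g) (hF : A.globalMap c₁ = A.globalMap c₂) :
    ¬ A.Preinjective := by
  classical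
  obtain ⟨n₀, hn₀⟩ := A.nbhd_nonempty
  let E : Finset G := (U ×ˢ A.nbhd ×ˢ A.nbhd).image fun p => p.1 * p.2.1⁻¹ * p.2.2
  have hE : ∀ u ∈ U, ∀ m ∈ A.nbhd, ∀ n ∈ A.nbhd, u * m⁻¹ * n ∈ E := fun u hu m hm n hn =>
    Finset.mem_image.2 ⟨(u, m, n), by simp [hu, hm, hn], rfl⟩
  refine not_not.2 ⟨E, fun x => c₁ x, fun x => c₂ x, fun h => hne (funext fun g => ?_), ?_⟩
  · by_cases hg : g ∈ U
    · exact congrFun h ⟨g, by simpa using hE g hg n₀ hn₀ n₀ hn₀⟩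
    · exact hoff g hg
  · intro d₁ d₂ h₁ h₂ hd
    funext g
    by_cases hg : ∃ m ∈ A.nbhd, g * m ∈ U
    · obtain ⟨m, hm, hgm⟩ := hg
      have hgE : ∀ n ∈ A.nbhd, g * n ∈ E := fun n hn => by
        simpa using hE _ hgm m hm n hn
      rw [A.globalMap_congr (c' := c₁) fun n hn => h₁ ⟨_, hgE n hn⟩, hF,
        A.globalMap_congr (c' := d₂) fun n hn => (h₂ ⟨_, hgE n hn⟩).symm]
    · push Not at hg
      refine A.globalMap_congr fun n hn => ?_
      by_cases hE' : g * n ∈ E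
      · rw [h₁ ⟨_, hE'⟩, h₂ ⟨_, hE'⟩]
        exact hoff _ (hg n hn)
      · exact hd _ hE'

/-- Configurations with a fixed background off `U` have images that agree off
`V = U ∪ ∂_N U`. For a preinjective automaton they are therefore determined by the restrictions of
their images to `V`, all of which avoid the orphan `p|_E` on the tiles in `U`. -/
theorem Preinjective.card_pow_le [Fintype Q] [Nonempty Q] (hA : A.Preinjective)
    {E : Finset G} {p : G → Q} (hp : ∀ c : G → Q, ∃ e ∈ E, A.globalMap c e ≠ p e)
    {S : Set G} (hS : IsTilePacking E S) (U : Finset G) :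
    (Fintype.card Q : ℝ) ^ U.card ≤
      (Fintype.card Q : ℝ) ^ (U.card + (boundaryWrt A.nbhd U).ncard) *
        (1 - ((Fintype.card Q : ℝ) ^ E.card)⁻¹) ^ (tilesIn E S U).ncard := by
  classical
  have hE : E.Nonempty := (hp p).imp fun _ h => h.1
  have hB := boundaryWrt_finite A.nbhd U
  have hT := tilesIn_finite hE S U
  let V : Finset G := U ∪ hB.toFinset
  have hUV : U ⊆ V := Finset.subset_union_left
  have hV : V.card ≤ U.card + (boundaryWrt A.nbhd U).ncard := by
    rw [Set.ncard_eq_toFinset_card _ hB]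
    exact Finset.card_union_le _ _
  let ext : (U → Q) → G → Q := fun u g =>
    if hg : g ∈ U then u ⟨g, hg⟩ else Classical.arbitrary Q
  have hext : ∀ u (x : U), ext u x = u x := fun u x => by simp [ext]
  let Φ : (U → Q) → V → Q := fun u v => A.globalMap (ext u) v
  have hΦ : Function.Injective Φ := by
    intro u w huw
    by_contra hne
    refine not_preinjective_of_globalMap_eq (U := U) (c₁ := ext u) (c₂ := ext w)
      (fun h => hne ?_) (fun g hg => by simp [ext, hg]) ?_ hA
    · funext x
      rw [← hext u x, h, hext w x]
    · funext g
      by_cases hg : g ∈ V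
      · exact congrFun huw ⟨g, hg⟩
      · refine A.globalMap_congr fun n hn => ?_
        have hgn : g * n ∉ U := fun h => hg <| by
          by_cases hgU : g ∈ U
          · exact hUV hgU
          · refine Finset.mem_union_right _ (hB.mem_toFinset.2 ⟨⟨n, hn, h⟩, ?_⟩)
            simpa using hgU
        simp [ext, hgn]
  let τ : hT.toFinset → E → V := fun s e =>
    ⟨s * e, hUV ((hT.mem_toFinset.1 s.2).2 e e.2)⟩
  have hτ : ∀ s t e f, τ s e = τ t f → s = t ∧ e = f := by
    intro s t e f h
    have h' : (s : G) * e = t * f := congrArg Subtype.val h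
    have hst : (s : G) = t :=
      hS _ (hT.mem_toFinset.1 s.2).1 _ (hT.mem_toFinset.1 t.2).1 _ e.2 _ f.2 h'
    rw [hst] at h'
    exact ⟨Subtype.ext hst, Subtype.ext (mul_left_cancel h')⟩
  have hav := card_avoiding_le τ hτ (fun e : E => p e) Finset.univ
  rw [Finset.card_univ, Fintype.card_coe, Fintype.card_coe, Fintype.card_coe,
    ← Set.ncard_eq_toFinset_card _ hT] at hav
  have hq : (1 : ℝ) ≤ Fintype.card Q := Nat.one_le_cast.2 Fintype.card_pos
  have hr : 0 ≤ 1 - ((Fintype.card Q : ℝ) ^ E.card)⁻¹ :=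
    sub_nonneg.2 (inv_le_one_of_one_le₀ (one_le_pow₀ hq))
  refine (le_trans ?_ hav).trans
    (mul_le_mul_of_nonneg_right (pow_le_pow_right₀ hq hV) (pow_nonneg hr _))
  have hU : Fintype.card Q ^ U.card = (Finset.univ : Finset (U → Q)).card := by simp
  rw [← Nat.cast_pow, hU, Nat.cast_le, ← Set.ncard_coe_finset]
  refine Set.ncard_le_ncard_of_injOn Φ (fun u _ s _ => ?_) hΦ.injOn (Set.toFinite _)
  obtain ⟨e, he, hne⟩ := orphan_translate hp (ext u) s
  exact ⟨⟨e, he⟩, hne⟩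

/-- **Myhill's theorem** for amenable groups. -/
theorem Preinjective.surjective [Finite Q] [Nontrivial Q] (hA : A.Preinjective)
    {Y : ℕ → Finset G} (hY : IsAmenableSeq Y) : Function.Surjective A.globalMap := by
  by_contra hns
  obtain ⟨E, p, hp⟩ := A.exists_orphan hns
  have hE : E.Nonempty := (hp p).imp fun _ h => h.1
  obtain ⟨S, hS⟩ := exists_isTileNet hE
  obtain ⟨δ, hδ, hden⟩ := hS.eventually_density_le hE hY
  have := Fintype.ofFinite Q
  set q : ℝ := (Fintype.card Q : ℝ) with hqdef
  have hq : 1 < q := by rw [hqdef]; exact_mod_cast Fintype.one_lt_card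
  have hlogq : 0 < Real.log q := Real.log_pos hq
  have hqE : 1 < q ^ E.card := one_lt_pow₀ hq hE.card_pos.ne'
  set r : ℝ := 1 - (q ^ E.card)⁻¹ with hr
  have hr0 : 0 < r := sub_pos.2 (inv_lt_one_of_one_lt₀ hqE)
  have hr1 : r < 1 := sub_lt_self _ (by positivity)
  have hlogr : Real.log r < 0 := Real.log_neg hr0 hr1
  -- With this bound on the boundary, `|∂U| * log q ≤ -(δ * |U| * log r) / 2`, which is less than
  -- the loss `-t * log r` caused by the `t ≥ δ * |U|` tiles.
  have hε : 0 < δ * -Real.log r / (2 * Real.log q) :=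
    div_pos (mul_pos hδ (neg_pos.2 hlogr)) (by positivity)
  obtain ⟨n, hn, hb, hpos⟩ := (hden.and ((hY.eventually_boundary_le A.nbhd_nonempty hε).and
    hY.eventually_card_pos)).exists
  have hcount := hA.card_pow_le hp hS.1 (Y n)
  rw [← hqdef, ← hr, pow_add, mul_assoc, le_mul_iff_one_le_right (by positivity)] at hcount
  have hlog := Real.log_nonneg hcount
  rw [Real.log_mul (by positivity) (by positivity), Real.log_pow, Real.log_pow] at hlog
  have h1 := mul_le_mul_of_nonneg_right hb hlogq.le
  have h2 := mul_le_mul_of_nonpos_right hn hlogr.le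
  have h3 : δ * -Real.log r / (2 * Real.log q) * (Y n).card * Real.log q =
      -(δ * (Y n).card * Real.log r) / 2 := by field_simp
  have hpos' : (0 : ℝ) < (Y n).card := by exact_mod_cast hpos
  have h4 : δ * (Y n).card * Real.log r < 0 := mul_neg_of_pos_of_neg (by positivity) hlogr
  linarith

end CellularAutomaton

end Besicovitch

theorem mainTheorem2 {G : Type*} [Group G] [Group.FG G] [Infinite G]
    {Q : Type*} [Finite Q] [Nontrivial Q]
    (X : ℕ → Finset G) (hX : Besicovitch.IsExhaustive X)
    (hsub : Besicovitch.HasAmenableSubseq X)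
    (A : Besicovitch.CellularAutomaton G Q) :
    (Besicovitch.BSurjective X A.globalMap → Function.Surjective A.globalMap) ∧
    (Besicovitch.BInjective X A.globalMap → A.Preinjective) ∧
    (Besicovitch.BInjective X A.globalMap → Besicovitch.BSurjective X A.globalMap) := by
  refine ⟨Besicovitch.CellularAutomaton.surjective_of_bSurjective hsub,
    Besicovitch.CellularAutomaton.preinjective_of_bInjective hsub, fun h c => ?_⟩
  have hA := Besicovitch.CellularAutomaton.preinjective_of_bInjective hsub h
  obtain ⟨φ, -, hY⟩ := hsub
  obtain ⟨c', rfl⟩ := hA.surjective hY c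
  exact ⟨c', Besicovitch.besicovitchDist_self X _⟩
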